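/- **Theorem 4.8.** Let $E_8$ be the $E_8$ root lattice (the free abelian group $\mathbb{Z}^8$ with the symmetric bilinear form whose Gram matrix is the Cartan matrix of type $E_8$), and let $O(E_8)$ be its isometry group. A root is a vector $r\in E_8$ with $(r,r)=2$, and $h\in O(E_8)$ is called rootless if the sublattice $(h-1)E_8$ contains no roots. Then $O(E_8)$ contains no rootless element of order $9$. -/

import Mathlib

/-- The isometry group `O(E)` of a lattice, i.e. of a `ℤ`-module `E` with a bilinear form `B`:
all `ℤ`-linear automorphisms `h` of `E` with `(h x, h y) = (x, y)` for all `x, y`. -/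
def latticeIsometryGroup {E : Type*} [AddCommGroup E] (B : LinearMap.BilinForm ℤ E) :
    Subgroup (E ≃ₗ[ℤ] E) where
  carrier := {h | ∀ x y, B (h x) (h y) = B x y}
  mul_mem' := fun {a b} ha hb x y => (ha (b x) (b y)).trans (hb x y)
  one_mem' := fun _ _ => rfl
  inv_mem' := fun {a} ha x y => by
    have h := ha (a.symm x) (a.symm y)
    rw [a.apply_symm_apply, a.apply_symm_apply] at h
    exact h.symm

/-- A root of an integral lattice is a vector of norm `(r, r) = 2`. -/
def IsLatticeRoot {E : Type*} [AddCommGroup E] (B : LinearMap.BilinForm ℤ E) (r : E) : Prop :=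
  B r r = 2

/-- An isometry `h ∈ O(E)` is rootless if the sublattice `(h - 1)E` contains no roots. -/
def IsRootless {E : Type*} [AddCommGroup E] (B : LinearMap.BilinForm ℤ E)
    (h : latticeIsometryGroup B) : Prop :=
  ∀ r ∈ LinearMap.range ((h : E ≃ₗ[ℤ] E).toLinearMap - LinearMap.id), ¬ IsLatticeRoot B r

/-- The `E₈` lattice: the free `ℤ`-module `ℤ⁸`, whose standard basis is a base of simple roots,
with the bilinear form whose Gram matrix is the Cartan matrix of type `E₈`. -/
def e8Form : LinearMap.BilinForm ℤ (Fin 8 → ℤ) :=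
  Matrix.toBilin' CartanMatrix.E₈

/-! Suppose `f` is a rootless isometry with `f ^ 9 = 1` and `f ^ 3 ≠ 1`. Its powers are rootless
too, so for a root `r` each `(r, f^k r)` is `0` or `-1` unless `f^k` fixes `r`. If `f^3 r ≠ r`,
nonnegativity of the norm of the orbit sum allows at most one `-1` among `k = 1, 2, 3, 4`, and rank
8 forces one. At `k = 1, 2, 4` the orbit would be an extended `A₈` diagram, and a glue vector of
`E₈` over `A₈` yields a root in the range (`exists_root_in_range_of_A8_orbit`). So it is at `k = 3`,
and `r + f^3 r + f^6 r` has norm 0 (`root_cube_cases`). Roots fixed by `f^3` are orthogonal to roots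
killed by `Φ₉(f)`; as the diagram is connected, all simple roots are of one kind. Hence `f^3 = 1` or
`Φ₉(f) = 0`, and the latter fails because 6 does not divide 8. -/

/-! ### Positive definiteness of the form -/

theorem e8Form_apply (x y : Fin 8 → ℤ) : e8Form x y =
    2 * (x 0 * y 0 + x 1 * y 1 + x 2 * y 2 + x 3 * y 3 + x 4 * y 4 + x 5 * y 5 + x 6 * y 6
      + x 7 * y 7)
    - (x 0 * y 2 + x 2 * y 0) - (x 1 * y 3 + x 3 * y 1) - (x 2 * y 3 + x 3 * y 2)
    - (x 3 * y 4 + x 4 * y 3) - (x 4 * y 5 + x 5 * y 4) - (x 5 * y 6 + x 6 * y 5)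
    - (x 6 * y 7 + x 7 * y 6) := by
  simp [e8Form, Matrix.toBilin'_apply, CartanMatrix.E₈, Fin.sum_univ_eight]
  ring

theorem e8Form_comm (x y : Fin 8 → ℤ) : e8Form x y = e8Form y x := by
  simp only [e8Form_apply]; ring

/-- Complete squares inward from the two short arms, then outward along the long arm; 60 clears
denominators. -/
theorem e8Form_sum_of_squares (x : Fin 8 → ℤ) : 60 * e8Form x x =
    30 * (2 * x 0 - x 2) ^ 2 + 30 * (2 * x 1 - x 3) ^ 2 + 10 * (3 * x 2 - 2 * x 3) ^ 2
    + 2 * (5 * x 3 - 6 * x 4) ^ 2 + 3 * (4 * x 4 - 5 * x 5) ^ 2 + 5 * (3 * x 5 - 4 * x 6) ^ 2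
    + 10 * (2 * x 6 - 3 * x 7) ^ 2 + 30 * x 7 ^ 2 := by
  rw [e8Form_apply]; ring

theorem e8Form_self_nonneg (x : Fin 8 → ℤ) : 0 ≤ e8Form x x := by
  have h := e8Form_sum_of_squares x
  have : 0 ≤ 60 * e8Form x x := by rw [h]; positivity
  omega

theorem eq_zero_of_e8Form_self_eq_zero {x : Fin 8 → ℤ} (hx : e8Form x x = 0) : x = 0 := by
  have h := e8Form_sum_of_squares x
  rw [hx] at h
  have h0 := sq_nonneg (2 * x 0 - x 2)
  have h1 := sq_nonneg (2 * x 1 - x 3)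
  have h2 := sq_nonneg (3 * x 2 - 2 * x 3)
  have h3 := sq_nonneg (5 * x 3 - 6 * x 4)
  have h4 := sq_nonneg (4 * x 4 - 5 * x 5)
  have h5 := sq_nonneg (3 * x 5 - 4 * x 6)
  have h6 := sq_nonneg (2 * x 6 - 3 * x 7)
  have h7 := sq_nonneg (x 7)
  have e0 : 2 * x 0 - x 2 = 0 := sq_eq_zero_iff.1 (by linarith)
  have e1 : 2 * x 1 - x 3 = 0 := sq_eq_zero_iff.1 (by linarith)
  have e2 : 3 * x 2 - 2 * x 3 = 0 := sq_eq_zero_iff.1 (by linarith)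
  have e3 : 5 * x 3 - 6 * x 4 = 0 := sq_eq_zero_iff.1 (by linarith)
  have e4 : 4 * x 4 - 5 * x 5 = 0 := sq_eq_zero_iff.1 (by linarith)
  have e5 : 3 * x 5 - 4 * x 6 = 0 := sq_eq_zero_iff.1 (by linarith)
  have e6 : 2 * x 6 - 3 * x 7 = 0 := sq_eq_zero_iff.1 (by linarith)
  have e7 : x 7 = 0 := sq_eq_zero_iff.1 (by linarith)
  funext i
  fin_cases i <;> simp only [Fin.zero_eta, Fin.mk_one, Fin.reduceFinMk, Pi.zero_apply] <;> omega

/-- Otherwise `ℚ⁸` would be a vector space over the ninth cyclotomic field, which has degree 6. -/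
theorem no_ninth_root_action (f : Module.End ℤ (Fin 8 → ℤ)) : f ^ 6 + f ^ 3 + 1 ≠ 0 := by
  intro hf
  let A : Matrix (Fin 8) (Fin 8) ℚ := (LinearMap.toMatrixAlgEquiv' f).map (Int.castRingHom ℚ)
  have hA : A ^ 6 + A ^ 3 + 1 = 0 := by
    have h := congrArg (fun g => (Int.castRingHom ℚ).mapMatrix (LinearMap.toMatrixAlgEquiv' g)) hf
    simp only [map_add, map_pow, map_one, map_zero] at h
    exact h
  have : Fact (Irreducible (Polynomial.cyclotomic 9 ℚ)) :=
    ⟨Polynomial.cyclotomic.irreducible_rat (by norm_num)⟩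
  have hc : (Polynomial.cyclotomic 9 ℚ) = Polynomial.X ^ 6 + Polynomial.X ^ 3 + 1 := by
    have := Polynomial.cyclotomic_prime_pow_eq_geom_sum (R := ℚ) (n := 1) Nat.prime_three
    norm_num [Finset.sum_range_succ] at this
    rw [this]; ring
  let T : Module.End ℚ (Fin 8 → ℚ) := Matrix.toLinAlgEquiv' A
  have hT : Polynomial.aeval T (Polynomial.cyclotomic 9 ℚ) = 0 := by
    have h := congrArg Matrix.toLinAlgEquiv' hA
    simp only [map_add, map_pow, map_one, map_zero] at h
    simpa [hc] using h
  let K := AdjoinRoot (Polynomial.cyclotomic 9 ℚ)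
  let φ : K →ₐ[ℚ] Module.End ℚ (Fin 8 → ℚ) := Ideal.Quotient.liftₐ _ (Polynomial.aeval T) (by
    intro a ha
    obtain ⟨b, rfl⟩ := Ideal.mem_span_singleton'.1 ha
    rw [map_mul, hT, mul_zero])
  let _ : Module K (Fin 8 → ℚ) := Module.compHom _ φ.toRingHom
  have : IsScalarTower ℚ K (Fin 8 → ℚ) := ⟨fun q k v => by
    change φ (q • k) v = q • φ k v
    simp⟩
  have hd := Module.finrank_mul_finrank ℚ K (Fin 8 → ℚ)
  have h6 : Module.finrank ℚ K = 6 := by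
    rw [(AdjoinRoot.powerBasis (Polynomial.cyclotomic_ne_zero 9 ℚ)).finrank,
      AdjoinRoot.powerBasis_dim, Polynomial.natDegree_cyclotomic]
    decide
  rw [h6, Module.finrank_fin_fun] at hd
  omega

/-! ### The glue of `E₈` over `A₈`, modulo 3 -/

theorem A8_mod_three : (CartanMatrix.A 8).map (Int.cast : ℤ → ZMod 3) =
    !![2, 2, 0, 0, 0, 0, 0, 0; 2, 2, 2, 0, 0, 0, 0, 0; 0, 2, 2, 2, 0, 0, 0, 0;
      0, 0, 2, 2, 2, 0, 0, 0; 0, 0, 0, 2, 2, 2, 0, 0; 0, 0, 0, 0, 2, 2, 2, 0;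
      0, 0, 0, 0, 0, 2, 2, 2; 0, 0, 0, 0, 0, 0, 2, 2] := by decide

theorem A8_mod_three_vecMul : (![1, 2, 0, 1, 2, 0, 1, 2] : Fin 8 → ZMod 3) ≠ 0 ∧
    Matrix.vecMul ![1, 2, 0, 1, 2, 0, 1, 2]
      ((CartanMatrix.A 8).map (Int.cast : ℤ → ZMod 3)) = 0 := by decide

/-- The Gram matrix of `A₈` is singular mod 3 while that of `E₈` is unimodular, so the rows `r i`
are dependent mod 3. The relation lies in the kernel of the `A₈` matrix, a line, which determines
the coefficients. -/
theorem a8_chain_combination_mod_three (r : Fin 8 → Fin 8 → ℤ)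
    (h : ∀ i j, e8Form (r i) (r j) = CartanMatrix.A 8 i j) (j : Fin 8) :
    (3 : ℤ) ∣ 2 * r 0 j + r 1 j + 2 * r 3 j + r 4 j + 2 * r 6 j + r 7 j := by
  have : Fact (Nat.Prime 3) := ⟨Nat.prime_three⟩
  let π := Int.castRingHom (ZMod 3)
  let P : Matrix (Fin 8) (Fin 8) ℤ := Matrix.of r
  have hP : P * CartanMatrix.E₈ * P.transpose = CartanMatrix.A 8 := by
    ext i j
    rw [← h i j, e8Form, Matrix.toBilin'_apply', Matrix.mul_assoc, Matrix.mul_apply]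
    simp [dotProduct, Matrix.mulVec, Matrix.mul_apply, P]
  have hP3 := congrArg π.mapMatrix hP
  rw [map_mul, map_mul] at hP3
  set Q := π.mapMatrix P with hQ
  have hA : (π.mapMatrix (CartanMatrix.A 8)).det = 0 := by
    rw [← Matrix.exists_vecMul_eq_zero_iff]
    exact ⟨_, A8_mod_three_vecMul⟩
  have hE : (π.mapMatrix CartanMatrix.E₈).det = 1 := by
    rw [← RingHom.map_det, CartanMatrix.E₈_det, map_one]
  have hQ0 : Q.det = 0 := by
    have := congrArg Matrix.det hP3
    rw [hA, Matrix.det_mul, Matrix.det_mul, hE] at this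
    have ht : (π.mapMatrix P.transpose).det = Q.det := by
      rw [← Matrix.det_transpose]; rfl
    rw [ht] at this
    simpa using this
  obtain ⟨v, hv, hv0⟩ := Matrix.exists_vecMul_eq_zero_iff.2 hQ0
  have hvA : Matrix.vecMul v ((CartanMatrix.A 8).map (Int.cast : ℤ → ZMod 3)) = 0 := by
    change Matrix.vecMul v (π.mapMatrix (CartanMatrix.A 8)) = 0
    rw [← hP3, ← Matrix.vecMul_vecMul, ← Matrix.vecMul_vecMul, hv0]; simp
  rw [A8_mod_three] at hvA
  have e := fun i => congrFun hvA i
  simp [Fin.forall_fin_succ, Matrix.vecMul, dotProduct, Fin.sum_univ_eight] at e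
  have h3 : (3 : ZMod 3) = 0 := rfl
  obtain ⟨e0, e1, e2, e3, e4, e5, e6, e7⟩ := e
  -- 2 is its own inverse mod 3, so each equation gives the next coordinate.
  have d1 : v 1 = -v 0 := by linear_combination 2 * e0 - (v 0 + v 1) * h3
  have d2 : v 2 = 0 := by linear_combination 2 * e1 - d1 - (v 0 + v 1 + v 2) * h3
  have d3 : v 3 = v 0 := by linear_combination 2 * e2 - d2 - d1 - (v 1 + v 2 + v 3) * h3
  have d4 : v 4 = -v 0 := by linear_combination 2 * e3 - d3 - d2 - (v 2 + v 3 + v 4) * h3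
  have d5 : v 5 = 0 := by linear_combination 2 * e4 - d4 - d3 - (v 3 + v 4 + v 5) * h3
  have d6 : v 6 = v 0 := by linear_combination 2 * e5 - d5 - d4 - (v 4 + v 5 + v 6) * h3
  have d7 : v 7 = -v 0 := by linear_combination 2 * e6 - d6 - d5 - (v 5 + v 6 + v 7) * h3
  have hv00 : v 0 ≠ 0 := by
    intro h0
    apply hv
    funext i
    fin_cases i <;> simp [d1, d2, d3, d4, d5, d6, d7, h0]
  have hj : v 0 * (Q 0 j - Q 1 j + Q 3 j - Q 4 j + Q 6 j - Q 7 j) = 0 := by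
    have := congrFun hv0 j
    simp only [Matrix.vecMul, dotProduct, Fin.sum_univ_eight, d1, d2, d3, d4, d5, d6, d7,
      Pi.zero_apply] at this
    linear_combination this
  have hj' := (mul_eq_zero.1 hj).resolve_left hv00
  have hQj : ∀ i, Q i j = (r i j : ZMod 3) := fun i => rfl
  simp only [hQj] at hj'
  refine (ZMod.intCast_zmod_eq_zero_iff_dvd _ 3).1 ?_
  push_cast
  linear_combination -hj' + ((r 0 j : ZMod 3) + r 3 j + r 6 j) * h3

theorem card_le_eight_of_orthogonal {n : ℕ} (v : Fin n → Fin 8 → ℤ)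
    (hv : ∀ i, e8Form (v i) (v i) ≠ 0)
    (ho : ∀ i j, i < j → e8Form (v i) (v j) = 0) : n ≤ 8 := by
  have hl : LinearIndependent ℤ v := by
    rw [Fintype.linearIndependent_iff]
    intro c hc i
    have h0 : e8Form (∑ j, c j • v j) (v i) = 0 := by rw [hc]; simp
    rw [map_sum, LinearMap.sum_apply, Finset.sum_eq_single i] at h0
    · simpa only [map_smul, LinearMap.smul_apply, smul_eq_mul, mul_eq_zero, hv i, or_false] using h0
    · intro j _ hj
      rw [map_smul, LinearMap.smul_apply]
      rcases lt_or_gt_of_ne hj with h | h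
      · rw [ho j i h, smul_zero]
      · rw [e8Form_comm, ho i j h, smul_zero]
    · simp
  simpa using hl.fintype_card_le_finrank

theorem e8Form_sub_self (x y : Fin 8 → ℤ) :
    e8Form (x - y) (x - y) = e8Form x x + e8Form y y - 2 * e8Form x y := by
  simp only [map_sub, LinearMap.sub_apply, e8Form_comm y x]; ring

theorem e8Form_add_self (x y : Fin 8 → ℤ) :
    e8Form (x + y) (x + y) = e8Form x x + e8Form y y + 2 * e8Form x y := by
  simp only [map_add, LinearMap.add_apply, e8Form_comm y x]; ring

theorem E8_diagram_connected (p : Fin 8 → Prop)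
    (h : ∀ i j, CartanMatrix.E₈ i j ≠ 0 → p i → p j) (i j : Fin 8) : p i → p j := by
  have key (i : Fin 8) : p i ↔ p 3 := by
    have e (i j : Fin 8) (hij : CartanMatrix.E₈ i j ≠ 0 ∧ CartanMatrix.E₈ j i ≠ 0) : p i ↔ p j :=
      ⟨h i j hij.1, h j i hij.2⟩
    have e23 := e 2 3 (by decide)
    have e43 := e 4 3 (by decide)
    have e53 := (e 5 4 (by decide)).trans e43
    have e63 := (e 6 5 (by decide)).trans e53
    fin_cases i
    exacts [(e 0 2 (by decide)).trans e23, e 1 3 (by decide), e23, Iff.rfl, e43, e53, e63,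
      (e 7 6 (by decide)).trans e63]
  exact ((key i).trans (key j).symm).1

/-! ### Root orbits under an isometry with ninth power 1 -/

section Isometry

variable {f : Module.End ℤ (Fin 8 → ℤ)}

theorem e8Form_pow_apply (hf : ∀ x y, e8Form (f x) (f y) = e8Form x y) (k : ℕ)
    (x y : Fin 8 → ℤ) : e8Form ((f ^ k) x) ((f ^ k) y) = e8Form x y := by
  induction k with
  | zero => simp
  | succ k ih => rw [pow_succ', Module.End.mul_apply, Module.End.mul_apply, hf, ih]

theorem e8Form_pow_pow (hf : ∀ x y, e8Form (f x) (f y) = e8Form x y) (h9 : f ^ 9 = 1)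
    (x y : Fin 8 → ℤ) {i : ℕ} (hi : i ≤ 9) (j : ℕ) :
    e8Form ((f ^ i) x) ((f ^ j) y) = e8Form x ((f ^ ((9 - i + j) % 9)) y) := by
  rw [← pow_eq_pow_mod _ h9, ← e8Form_pow_apply hf (9 - i), ← Module.End.mul_apply,
    ← Module.End.mul_apply, ← pow_add, ← pow_add, Nat.sub_add_cancel hi, h9, Module.End.one_apply]

theorem e8Form_pow_symm (hf : ∀ x y, e8Form (f x) (f y) = e8Form x y) (h9 : f ^ 9 = 1)
    (x : Fin 8 → ℤ) {i : ℕ} (hi : i ≤ 9) :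
    e8Form x ((f ^ (9 - i)) x) = e8Form x ((f ^ i) x) := by
  have h := e8Form_pow_pow hf h9 x x hi 0
  rw [e8Form_comm x ((f ^ i) x), add_zero, ← pow_eq_pow_mod _ h9] at *
  simpa using h.symm

theorem exists_root_in_range_of_A8_orbit (hf : ∀ x y, e8Form (f x) (f y) = e8Form x y)
    (h9 : f ^ 9 = 1) {r : Fin 8 → ℤ} (hr : e8Form r r = 2) (h1 : e8Form r (f r) = -1)
    (h2 : e8Form r ((f ^ 2) r) = 0) (h3 : e8Form r ((f ^ 3) r) = 0)
    (h4 : e8Form r ((f ^ 4) r) = 0) : ∃ w, e8Form (f w - w) (f w - w) = 2 := by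
  have h1' : e8Form r ((f ^ 1) r) = -1 := by rwa [pow_one]
  have h5 : e8Form r ((f ^ 5) r) = 0 := (e8Form_pow_symm hf h9 r (i := 4) (by simp)).trans h4
  have h6 : e8Form r ((f ^ 6) r) = 0 := (e8Form_pow_symm hf h9 r (i := 3) (by simp)).trans h3
  have h7 : e8Form r ((f ^ 7) r) = 0 := (e8Form_pow_symm hf h9 r (i := 2) (by simp)).trans h2
  have h8 : e8Form r ((f ^ 8) r) = -1 := (e8Form_pow_symm hf h9 r (i := 1) (by simp)).trans h1'
  have hs : ∑ i ∈ Finset.range 9, (f ^ i) r = 0 := by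
    apply eq_zero_of_e8Form_self_eq_zero
    simp only [map_sum, LinearMap.sum_apply]
    apply Finset.sum_eq_zero
    intro i hi
    rw [Finset.mem_range] at hi
    simp only [e8Form_comm ((f ^ _) r) ((f ^ i) r), e8Form_pow_pow hf h9 r r hi.le]
    interval_cases i <;>
      simp [Finset.sum_range_succ, hr, h1, h2, h3, h4, h5, h6, h7, h8]
  have hd := a8_chain_combination_mod_three (fun i => (f ^ (i : ℕ)) r) (by
    intro i j
    rw [e8Form_pow_pow hf h9 r r (by omega)]
    fin_cases i <;> fin_cases j <;>
      simp [CartanMatrix.A, hr, h1, h2, h3, h4, h5, h6, h7, h8])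
  choose w hw using hd
  let a : ℕ → Fin 8 → ℤ := fun i => (f ^ i) r
  -- The shifted vector is the fundamental weight of `A₈` dual to `a 2`; modulo the orbit sum, `f -
  -- 1` sends it to `-(a 0 + a 1 + a 2)`.
  have hu : (3 : ℤ) • (w + (a 1 + 2 • a 2 + a 3 + a 4 + a 5)) =
      (2 : ℤ) • a 0 + (4 : ℤ) • a 1 + (6 : ℤ) • a 2 + (5 : ℤ) • a 3 + (4 : ℤ) • a 4 + (3 : ℤ) • a 5
        + (2 : ℤ) • a 6 + a 7 := by
    funext j
    have := hw j
    simp only [Pi.smul_apply, Pi.add_apply, smul_eq_mul, a, nsmul_eq_mul]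
    simp at this ⊢
    linear_combination -this
  have ha : ∀ i, f (a i) = a (i + 1) := fun i => by
    simp only [a, pow_succ', Module.End.mul_apply]
  have hsum : a 0 + a 1 + a 2 + a 3 + a 4 + a 5 + a 6 + a 7 + a 8 = 0 := by
    simpa only [Finset.sum_range_succ, Finset.sum_range_zero, zero_add] using hs
  generalize w + (a 1 + 2 • a 2 + a 3 + a 4 + a 5) = w' at hu
  have hfw : f w' - w' = -(a 0 + a 1 + a 2) := by
    have h3w : (3 : ℤ) • (f w' - w') = (3 : ℤ) • -(a 0 + a 1 + a 2) := by
      rw [smul_sub, ← map_smul, hu]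
      simp only [map_add, map_smul, ha]
      rw [← sub_eq_zero, ← hsum]
      module
    exact smul_right_injective _ (by norm_num) h3w
  refine ⟨w', ?_⟩
  have b01 : e8Form (a 0) (a 1) = -1 := by simpa [a] using h1
  have b02 : e8Form (a 0) (a 2) = 0 := by simpa [a] using h2
  have b12 : e8Form (a 1) (a 2) = -1 := by rw [← ha 0, ← ha 1, hf]; exact b01
  have b (i) : e8Form (a i) (a i) = 2 := (e8Form_pow_apply hf i r r).trans hr
  rw [hfw, map_neg, map_neg, LinearMap.neg_apply, neg_neg, e8Form_add_self, e8Form_add_self,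
    map_add, LinearMap.add_apply, b01, b02, b12, b, b, b]
  norm_num

theorem root_pow_orbit_cases (hf : ∀ x y, e8Form (f x) (f y) = e8Form x y)
    (h9 : f ^ 9 = 1) (hM : ∀ x, e8Form (f x - x) (f x - x) ≠ 2) {r : Fin 8 → ℤ}
    (hr : e8Form r r = 2) : f r = r ∨ e8Form r (f r) = 0 ∨ e8Form r (f r) = -1 := by
  have hfr : e8Form (f r) (f r) = 2 := (hf r r).trans hr
  have hs := e8Form_sub_self (f r) r
  have ha := e8Form_add_self (f r) r
  have hs0 := e8Form_self_nonneg (f r - r)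
  have ha0 := e8Form_self_nonneg (f r + r)
  have hM := hM r
  rw [e8Form_comm (f r) r, hfr, hr] at hs ha
  by_cases h2 : e8Form r (f r) = 2
  · left
    exact sub_eq_zero.1 (eq_zero_of_e8Form_self_eq_zero (by omega))
  right
  by_cases h2' : e8Form r (f r) = -2
  · exfalso
    have hneg : f r = -r :=
      eq_neg_of_add_eq_zero_left (eq_zero_of_e8Form_self_eq_zero (by omega))
    have h := LinearMap.congr_fun h9 r
    -- Nine is odd, so `f ^ 9` would negate `r`.
    simp only [pow_succ, pow_zero, Module.End.mul_apply, Module.End.one_apply, hneg, map_neg,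
      neg_neg] at h
    rw [neg_eq_self.1 h] at hr
    simp at hr
  omega

theorem rootless_pow (hM : ∀ x, e8Form (f x - x) (f x - x) ≠ 2) (k : ℕ) (x : Fin 8 → ℤ) :
    e8Form ((f ^ k) x - x) ((f ^ k) x - x) ≠ 2 := by
  have h := LinearMap.congr_fun (mul_geom_sum f k) x
  simp only [Module.End.mul_apply, LinearMap.sub_apply, Module.End.one_apply] at h
  rw [← h]
  exact hM _

theorem pow_nine_pow (h9 : f ^ 9 = 1) (k : ℕ) : (f ^ k) ^ 9 = 1 := by
  rw [← pow_mul, mul_comm, pow_mul, h9, one_pow]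

theorem root_cube_cases (hf : ∀ x y, e8Form (f x) (f y) = e8Form x y)
    (h9 : f ^ 9 = 1) (hM : ∀ x, e8Form (f x - x) (f x - x) ≠ 2) {r : Fin 8 → ℤ}
    (hr : e8Form r r = 2) : (f ^ 3) r = r ∨ (f ^ 6 + f ^ 3 + 1 : Module.End ℤ (Fin 8 → ℤ)) r = 0 := by
  by_cases h3 : (f ^ 3) r = r
  · exact Or.inl h3
  right
  have hc (k : ℕ) := root_pow_orbit_cases (e8Form_pow_apply hf k) (pow_nine_pow h9 k)
    (rootless_pow hM k) hr
  have hmul (i j : ℕ) : (f ^ (i + j)) r = (f ^ i) ((f ^ j) r) := by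
    rw [pow_add, Module.End.mul_apply]
  have n1 : (f ^ 1) r ≠ r := fun h => h3 (by rw [hmul 2 1, h, hmul 1 1, h, h])
  have h9r : (f ^ 9) r = r := by rw [h9, Module.End.one_apply]
  have n4 : (f ^ 4) r ≠ r := fun h => n1 (by
    rw [hmul 1 8, hmul 4 4, h, h] at h9r; exact h9r)
  have n2 : (f ^ 2) r ≠ r := fun h => n4 (by rw [hmul 2 2, h, h])
  have c1 := (hc 1).resolve_left n1
  have c2 := (hc 2).resolve_left n2
  have c3 := (hc 3).resolve_left h3
  have c4 := (hc 4).resolve_left n4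
  have h5 : e8Form r ((f ^ 5) r) = _ := e8Form_pow_symm hf h9 r (i := 4) (by simp)
  have h6 : e8Form r ((f ^ 6) r) = _ := e8Form_pow_symm hf h9 r (i := 3) (by simp)
  have h7 : e8Form r ((f ^ 7) r) = _ := e8Form_pow_symm hf h9 r (i := 2) (by simp)
  have h8 : e8Form r ((f ^ 8) r) = _ := e8Form_pow_symm hf h9 r (i := 1) (by simp)
  have hsum : 0 ≤ 9 * (2 + 2 * (e8Form r ((f ^ 1) r) + e8Form r ((f ^ 2) r) +
      e8Form r ((f ^ 3) r) + e8Form r ((f ^ 4) r))) := by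
    have h := e8Form_self_nonneg (∑ i ∈ Finset.range 9, (f ^ i) r)
    convert h using 1
    simp only [map_sum, LinearMap.sum_apply]
    rw [Finset.sum_comm, Finset.sum_congr rfl (g := fun _ => 2 + 2 * (e8Form r ((f ^ 1) r) +
      e8Form r ((f ^ 2) r) + e8Form r ((f ^ 3) r) + e8Form r ((f ^ 4) r)))]
    · simp
    intro i hi
    rw [Finset.mem_range] at hi
    simp only [e8Form_pow_pow hf h9 r r hi.le]
    have h0 : e8Form r ((f ^ 0) r) = 2 := by simpa using hr
    interval_cases i <;>
      simp only [Finset.sum_range_succ, Finset.sum_range_zero, Nat.reduceSub, Nat.reduceAdd,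
        Nat.reduceMod, h0, h5, h6, h7, h8] <;> ring
  have hnot : ¬ (e8Form r ((f ^ 1) r) = 0 ∧ e8Form r ((f ^ 2) r) = 0 ∧
      e8Form r ((f ^ 3) r) = 0 ∧ e8Form r ((f ^ 4) r) = 0) := by
    rintro ⟨z1, z2, z3, z4⟩
    have := card_le_eight_of_orthogonal (fun i : Fin 9 => (f ^ (i : ℕ)) r)
      (fun i => by rw [e8Form_pow_apply hf, hr]; norm_num) (fun i j hij => by
        obtain ⟨k, hk⟩ := Nat.exists_eq_add_of_lt hij
        have hk8 : k < 8 := by omega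
        rw [hk, add_assoc, hmul i, e8Form_pow_apply hf]
        interval_cases k <;> simp only [Nat.reduceAdd, z1, z2, z3, z4, h5, h6, h7, h8])
    omega
  -- For `k` prime to 3, replacing `f` by `f ^ k` merely reorders the orbit.
  have key (k : ℕ) (a1 : e8Form r ((f ^ k) r) = -1) (a2 : e8Form r ((f ^ (k * 2)) r) = 0)
      (a3 : e8Form r ((f ^ (k * 3)) r) = 0) (a4 : e8Form r ((f ^ (k * 4)) r) = 0) : False := by
    rw [pow_mul] at a2 a3 a4
    obtain ⟨w, hw⟩ := exists_root_in_range_of_A8_orbit (e8Form_pow_apply hf k)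
      (pow_nine_pow h9 k) hr a1 a2 a3 a4
    exact rootless_pow hM k w hw
  have b1 : e8Form r ((f ^ 1) r) ≠ -1 := fun h => by
    refine key 1 h ?_ ?_ ?_ <;> simp only [Nat.reduceMul] <;> omega
  have b2 : e8Form r ((f ^ 2) r) ≠ -1 := fun h => by
    refine key 2 h ?_ ?_ ?_ <;> simp only [Nat.reduceMul] <;> omega
  have b4 : e8Form r ((f ^ 4) r) ≠ -1 := fun h => by
    refine key 4 h ?_ ?_ ?_ <;> simp only [Nat.reduceMul]
    · omega
    · rw [pow_eq_pow_mod 12 h9]; simp only [Nat.reduceMod]; omega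
    · rw [pow_eq_pow_mod 16 h9]; simp only [Nat.reduceMod]; omega
  have c3' : e8Form r ((f ^ 3) r) = -1 := by omega
  apply eq_zero_of_e8Form_self_eq_zero
  have c36 : e8Form ((f ^ 6) r) ((f ^ 3) r) = -1 := by
    rw [e8Form_comm, hmul 3 3, e8Form_pow_apply hf, c3']
  simp only [LinearMap.add_apply, Module.End.one_apply]
  rw [e8Form_add_self, e8Form_add_self, map_add, LinearMap.add_apply, e8Form_pow_apply hf,
    e8Form_pow_apply hf, c36, e8Form_comm ((f ^ 6) r) r,
    e8Form_comm ((f ^ 3) r) r, h6, c3', hr]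
  norm_num

theorem e8Form_eq_zero_of_fixed_of_cyclotomic (hf : ∀ x y, e8Form (f x) (f y) = e8Form x y)
    {r s : Fin 8 → ℤ} (hr : (f ^ 3) r = r) (hs : (f ^ 6 + f ^ 3 + 1 : Module.End ℤ (Fin 8 → ℤ)) s = 0) :
    e8Form r s = 0 := by
  have h6 : (f ^ 6) r = r := by
    rw [show 6 = 3 + 3 from rfl, pow_add, Module.End.mul_apply, hr, hr]
  have h := congrArg (e8Form r) hs
  have e3 := e8Form_pow_apply hf 3 r s
  have e6 := e8Form_pow_apply hf 6 r s
  rw [hr] at e3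
  rw [h6] at e6
  simp only [LinearMap.add_apply, Module.End.one_apply, map_add, map_zero, e3, e6] at h
  omega

theorem exists_root_in_range_of_pow_nine (hf : ∀ x y, e8Form (f x) (f y) = e8Form x y)
    (h9 : f ^ 9 = 1) (h3 : f ^ 3 ≠ 1) : ∃ x, e8Form (f x - x) (f x - x) = 2 := by
  by_contra! hM
  have hB (i j : Fin 8) : e8Form (Pi.single i 1) (Pi.single j 1) = CartanMatrix.E₈ i j :=
    Matrix.toBilin'_single _ i j
  have hcase (i : Fin 8) := root_cube_cases hf h9 hM (r := Pi.single i 1)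
    (by rw [hB, CartanMatrix.E₈_diag])
  have hadj (i j : Fin 8) (hij : CartanMatrix.E₈ i j ≠ 0) :
      (f ^ 3) (Pi.single i 1) = Pi.single i 1 → (f ^ 3) (Pi.single j 1) = Pi.single j 1 :=
    fun hi => (hcase j).resolve_right fun hj =>
      hij ((hB i j).symm.trans (e8Form_eq_zero_of_fixed_of_cyclotomic hf hi hj))
  have hconn := E8_diagram_connected _ hadj
  by_cases hfix : (f ^ 3) (Pi.single 0 1) = Pi.single 0 1
  · apply h3
    refine LinearMap.pi_ext' fun i => LinearMap.ext_ring ?_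
    exact hconn 0 i hfix
  · apply no_ninth_root_action f
    refine LinearMap.pi_ext' fun i => LinearMap.ext_ring ?_
    exact (hcase i).resolve_left fun hi => hfix (hconn i 0 hi)

end Isometry

theorem theorem4p8 :
    ¬ ∃ h : latticeIsometryGroup e8Form, orderOf h = 9 ∧ IsRootless e8Form h := by
  rintro ⟨h, ho, hroot⟩
  let F : latticeIsometryGroup e8Form →* Module.End ℤ (Fin 8 → ℤ) :=
    (LinearEquiv.automorphismGroup.toLinearMapMonoidHom).comp (Subgroup.subtype _)
  have hF : Function.Injective F := fun a b hab =>
    Subtype.ext (LinearEquiv.toLinearMap_injective hab)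
  have h9 : F h ^ 9 = 1 := by rw [← map_pow, ← ho, pow_orderOf_eq_one, map_one]
  have h3 : F h ^ 3 ≠ 1 := fun h3 => by
    rw [← map_pow, ← map_one F] at h3
    have := orderOf_dvd_of_pow_eq_one (hF h3)
    rw [ho] at this
    norm_num at this
  obtain ⟨x, hx⟩ := exists_root_in_range_of_pow_nine (f := F h) h.2 h9 h3
  exact hroot _ ⟨x, rfl⟩ hx
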